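/- Setting. There are $T$ episodes with rounds $1,\dots,H$. In episode $t$ the winning rounds are $W^t=\{w_1^t<\dots<w_{k_t}^t\}\subseteq\{1,\dots,H\}$, with the conventions $w_0^t=0$, $w^t_{k_t+1}=H+1$. For unknown parameters $\lambda_h$ and $\beta_h(\ell)$ ($1\le \ell\le h\le H$), the conversion times of episode $t$ form an inhomogeneous Poisson process with rate $$r^t(\tau)=\sum_{i=1}^{k_t} d_{w_i^t}(\tau;\,w_i^t-w_{i-1}^t),\qquad d_h(\tau;\ell)=\beta_h(\ell)\,\lambda_h e^{-\lambda_h(\tau-h)}\mathbf 1[\tau\ge h],$$ independently for different episodes. Pairwise moment matching for round $h$. Go through the episodes $t$ with $h\in W^t$ in any order, say $h=w_s^t$. Whenever possible, pick a not yet used episode $\phi(t)$ with $h\notin W^{\phi(t)}$, $w_r^{\phi(t)}=w_r^t$ for $0\le r\le s-1$ and $w_s^{\phi(t)}>h$, and mark $\phi(t)$ as used. Let $\Omega_h$ be the set of the episodes $t$ for which this succeeds, let $\Omega_{h,\ell}$ be the set of those $t\in\Omega_h$ with $h-w^t_{s-1}=\ell$, and let $n_h=|\Omega_h|$, $n_h(\ell)=|\Omega_{h,\ell}|$.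 Let $N_h^t$ and $\bar N_h^t$ be the numbers of conversions of episode $t$ in $[h,h+\frac12)$ and in $[h+\frac12,h+1)$, and let $X_h^t=N_h^t-N_h^{\phi(t)}$, $Y_h^t=\bar N_h^t-\bar N_h^{\phi(t)}$. Let $\hat\mu_h,\hat\eta_h$ be the means of $X_h^t,Y_h^t$ over $\Omega_h$, and $\hat\mu_{h\ell},\hat\eta_{h\ell}$ those over $\Omega_{h,\ell}$. The estimators are $$\hat\lambda_h=2(\log\hat\mu_h-\log\hat\eta_h),\qquad \hat\beta_h(\ell)=\frac{\hat\mu_{h\ell}^2}{\hat\mu_{h\ell}-\hat\eta_{h\ell}}.$$ Theorem. Let $c_\lambda,c_\beta,C_T>0$. Suppose that $\lambda_h\ge c_\lambda$ and $\beta_h(\ell)\ge c_\beta$ for all $1\le\ell\le h\le H$, and that for each episode the expected number of conversions within each interval $[k,k+1)$, $1\le k\le H$, is at most $C_T$. Let $0\le h\le H$ and $0\le\ell\le h$. 1. For every $C_\lambda$ there are positive constants $C_0,C_1$ depending only on $c_\lambda,C_\lambda,c_\beta,C_T$ such that, if $\lambda_h\le C_\lambda$ and $4e^{-C_0n_h}<\delta<1/2$,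 then with probability at least $1-\delta$ the estimator $\hat\lambda_h$ is well defined ($\hat\mu_h,\hat\eta_h>0$) and $$|\hat\lambda_h-\lambda_h|\le C_1\sqrt{\frac{\log(1/\delta)}{n_h}}.$$ 2. There are positive constants $C_0,C_2$ depending only on $c_\lambda,c_\beta,C_T$ such that, if $4e^{-C_0n_h(\ell)}<\delta<1/2$, then with probability at least $1-\delta$ the estimator $\hat\beta_h(\ell)$ is well defined ($\hat\mu_{h\ell}\ne\hat\eta_{h\ell}$) and $$|\hat\beta_h(\ell)-\beta_h(\ell)|\le C_2\sqrt{\frac{\log(1/\delta)}{n_h(\ell)}}.$$ -/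

import Mathlib

open MeasureTheory ProbabilityTheory
open scoped ENNReal NNReal

noncomputable section

/-- The parameters of an incrementality bidding instance: `lam h` is the decay rate `λ_h` and
`beta h ℓ` is the expected number `β_h(ℓ)` of conversions triggered by an ad shown at round `h`
when the previous ad was shown `ℓ` rounds earlier. -/
structure IBParams where
  lam : ℕ → ℝ
  beta : ℕ → ℕ → ℝ

/-- The last winning round before round `h` (and `0`, the convention `w_0 = 0`, if there is
none). -/
def lastWin (W : Finset ℕ) (h : ℕ) : ℕ := (W.filter (· < h)).sup id

/-- The number `ℓ` of rounds between round `h` and the last winning round before it. -/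
def gap (W : Finset ℕ) (h : ℕ) : ℕ := h - lastWin W h

/-- The incrementality rate function `d_h(τ; ℓ, θ_h)`: a re-scaled exponential density started
at time `h`. -/
def incrRate (θ : IBParams) (h ℓ : ℕ) (τ : ℝ) : ℝ :=
  if (h : ℝ) ≤ τ then θ.beta h ℓ * θ.lam h * Real.exp (-((τ - h) * θ.lam h)) else 0

/-- The conversion rate `r(τ; W, θ)` of an episode whose set of winning rounds is `W`. -/
def convRate (θ : IBParams) (W : Finset ℕ) (τ : ℝ) : ℝ :=
  ∑ w ∈ W, incrRate θ w (gap W w) τ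

/-- The intensity measure `A ↦ ∫_A r(τ) dτ` of a rate function. -/
def intensity (r : ℝ → ℝ) : Measure ℝ := volume.withDensity fun τ => ENNReal.ofReal (r τ)

/-- The random set of time stamps `S` is an inhomogeneous Poisson process with rate `r`: the
number of points in a Borel set `A` is Poisson with parameter `∫_A r` (almost surely infinite if
that integral is), and the numbers of points in disjoint Borel sets are independent. -/
structure IsPoissonProcess {Ω : Type*} [MeasurableSpace Ω] (r : ℝ → ℝ) (S : Ω → Set ℝ)
    (P : Measure Ω) : Prop where
  measurable_count : ∀ A : Set ℝ, MeasurableSet A → Measurable fun ω => (S ω ∩ A).encard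
  law_count : ∀ A : Set ℝ, MeasurableSet A → intensity r A ≠ ∞ →
    P.map (fun ω => (S ω ∩ A).encard) =
      (poissonMeasure (intensity r A).toNNReal).map (fun n : ℕ => (n : ℕ∞))
  top_count : ∀ A : Set ℝ, MeasurableSet A → intensity r A = ∞ →
    ∀ᵐ ω ∂P, (S ω ∩ A).encard = ⊤
  indep_count : ∀ (n : ℕ) (A : Fin n → Set ℝ), (∀ i, MeasurableSet (A i)) →
    (Pairwise fun i j => Disjoint (A i) (A j)) →
    iIndepFun (fun i ω => (S ω ∩ A i).encard) P

/-- The σ-algebra generated by a random set of time stamps, through its numbers of points in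
Borel sets. -/
abbrev pointSigma {Ω : Type*} (S : Ω → Set ℝ) : MeasurableSpace Ω :=
  ⨆ A : {A : Set ℝ // MeasurableSet A},
    MeasurableSpace.comap (fun ω => (S ω ∩ A.1).encard) inferInstance

/-- A sample of `T` episodes with `H` rounds each: episode `t` has the set of winning rounds
`W t ⊆ {1, …, H}` and the random set of conversion times `C t`; the conversion times of different
episodes are independent, and those of episode `t` form a Poisson process with rate
`r(·; W t, θ)`. -/
structure IsSample {Ω : Type*} [MeasurableSpace Ω] (θ : IBParams) (H T : ℕ)
    (W : Fin T → Finset ℕ) (C : Fin T → Ω → Set ℝ) (P : Measure Ω) : Prop where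
  wins_subset : ∀ t, W t ⊆ Finset.Icc 1 H
  poisson : ∀ t, IsPoissonProcess (convRate θ (W t)) (C t) P
  indep : iIndep (fun t => pointSigma (C t)) P

/-- The boundedness assumptions: `λ_h ≥ c_lam` and `β_h(ℓ) ≥ c_beta`, and the expected number of
conversions of each episode within each interval `[k, k + 1)` is at most `C_T`. -/
structure IsBounded (θ : IBParams) (H T : ℕ) (W : Fin T → Finset ℕ)
    (c_lam c_beta C_T : ℝ) : Prop where
  lam_ge : ∀ h ∈ Finset.Icc 1 H, c_lam ≤ θ.lam h
  beta_ge : ∀ h ∈ Finset.Icc 1 H, ∀ ℓ ∈ Finset.Icc 1 h, c_beta ≤ θ.beta h ℓ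
  mean_le : ∀ (t : Fin T), ∀ k ∈ Finset.Icc 1 H,
    intensity (convRate θ (W t)) (Set.Ico (k : ℝ) (k + 1)) ≤ ENNReal.ofReal C_T

/-- The winning rounds `V` can serve as the match of the winning rounds `W ∋ h`: both have the same
winning rounds before `h`, and the next winning round of `V`, if any, is after `h`. -/
def Matches (h : ℕ) (W V : Finset ℕ) : Prop :=
  W.filter (· < h) = V.filter (· < h) ∧ h ∉ V

/-- `MatchLoop W h ts L M φ`: the refining and matching loop for round `h`, run through the list
of episodes `ts` with `L` as the current set of available episodes, can end with the set `M` of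
matched episodes and the partner `φ t` for each `t ∈ M`. Any available matching episode may be
picked; an episode is passed over only if no available episode matches it. -/
inductive MatchLoop {T : ℕ} (W : Fin T → Finset ℕ) (h : ℕ) :
    List (Fin T) → Finset (Fin T) → Finset (Fin T) → (Fin T → Fin T) → Prop
  | done (L : Finset (Fin T)) (φ : Fin T → Fin T) : MatchLoop W h [] L ∅ φ
  | found {t : Fin T} {ts : List (Fin T)} {L M : Finset (Fin T)} {φ : Fin T → Fin T} :
      φ t ∈ L → Matches h (W t) (W (φ t)) → MatchLoop W h ts (L.erase (φ t)) M φ →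
      MatchLoop W h (t :: ts) L (insert t M) φ
  | pass {t : Fin T} {ts : List (Fin T)} {L M : Finset (Fin T)} {φ : Fin T → Fin T} :
      (∀ u ∈ L, ¬ Matches h (W t) (W u)) → MatchLoop W h ts L M φ →
      MatchLoop W h (t :: ts) L M φ

/-- `M` (the set `Ω_h`) and `φ` are a possible outcome of the matching part of the pairwise
moment-matching algorithm for round `h`: the loop visits once, in some order, each episode that
wins at round `h`, and the available episodes are at first those that do not win at `h`. -/
def IsMatching {T : ℕ} (W : Fin T → Finset ℕ) (h : ℕ) (M : Finset (Fin T))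
    (φ : Fin T → Fin T) : Prop :=
  ∃ ts : List (Fin T), ts.Nodup ∧ (∀ t, t ∈ ts ↔ h ∈ W t) ∧
    MatchLoop W h ts (Finset.univ.filter fun t => h ∉ W t) M φ

/-- The slice `Ω_{h,ℓ}` of the matched episodes. -/
def slice {T : ℕ} (W : Fin T → Finset ℕ) (h ℓ : ℕ) (M : Finset (Fin T)) : Finset (Fin T) :=
  M.filter fun t => gap (W t) h = ℓ

/-- The number `N_h` of conversions within `[h, h + 1/2)`, for conversion times `S`. -/
def firstCount (h : ℕ) (S : Set ℝ) : ℝ := ((S ∩ Set.Ico (h : ℝ) (h + 1 / 2)).ncard : ℝ)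

/-- The number `N̄_h` of conversions within `[h + 1/2, h + 1)`, for conversion times `S`. -/
def secondCount (h : ℕ) (S : Set ℝ) : ℝ := ((S ∩ Set.Ico ((h : ℝ) + 1 / 2) (h + 1)).ncard : ℝ)

/-- The mean of `X_h^t = N_h^t - N_h^{φ(t)}` over the episodes `t ∈ M`. -/
def muHat {T : ℕ} (h : ℕ) (M : Finset (Fin T)) (φ : Fin T → Fin T) (S : Fin T → Set ℝ) : ℝ :=
  (1 / (M.card : ℝ)) * ∑ t ∈ M, (firstCount h (S t) - firstCount h (S (φ t)))

/-- The mean of `Y_h^t = N̄_h^t - N̄_h^{φ(t)}` over the episodes `t ∈ M`. -/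
def etaHat {T : ℕ} (h : ℕ) (M : Finset (Fin T)) (φ : Fin T → Fin T) (S : Fin T → Set ℝ) : ℝ :=
  (1 / (M.card : ℝ)) * ∑ t ∈ M, (secondCount h (S t) - secondCount h (S (φ t)))

/-- The estimator `λ̂ = 2 (log μ̂ - log η̂)` of `λ_h`; a real number if `μ̂, η̂ > 0`. -/
def lamHat (μ η : ℝ) : ℝ := 2 * (Real.log μ - Real.log η)

/-- The estimator `β̂ = μ̂² / (μ̂ - η̂)` of `β_h(ℓ)`; a real number if `μ̂ ≠ η̂`. -/
def betaHat (μ η : ℝ) : ℝ := μ ^ 2 / (μ - η)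

end

/-!
Matched episodes `t` and `φ t` have the same winning rounds before `h`, so during round `h` their
rates differ exactly by the rate of the ad shown at `h` (`Matches.convRate_eq`). Hence, with
`λ = λ_h`, the differences `X` and `Y` have means `β (1 - e^{-λ/2})` and `β (e^{-λ/2} - e^{-λ})`
(`Matches.intensity_sub`). If `μ` and `η` are their averages over the matched episodes, then
`η = e^{-λ/2} μ`, so that `λ = 2 (log μ - log η)`; and on a slice with constant gap,
`μ² / (μ - η) = β`.

The matching never uses an episode twice and a match does not win at `h` (`IsMatching.spec`), so
the sums of the `X` and of the `Y` are sums of independent Poisson variables with weights `±1` and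
means at most `C_T`. Since `|e^x - 1 - x| ≤ x²` for `|x| ≤ 1`, a Chernoff bound shows that each
average over `n` pairs deviates by `ε ≤ 4 C_T` or more with probability at most
`2 e^{-n ε² / (8 C_T)}` (`poisson_pair_mean_tail`). Choosing `ε` such that the two bounds add up
to `δ` gives `ε` of order `√(log (1/δ) / n)`, and the lower bound on `δ` makes `ε` smaller than any
prescribed constant (`moments_close`).

The two estimators are Lipschitz near `(μ, η)`: the first because `μ` and `η` are bounded below in
terms of `c_lam`, `C_lam`, `c_beta` (`lamHat_stable`), the second because
`μ - η = β (1 - e^{-λ/2})²` is bounded below in terms of `c_lam` and `c_beta`, while `μ ≤ C_T`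
bounds `β` above (`betaHat_stable`).
-/

/-! ### Chernoff bound for weighted sums of independent Poisson variables -/

lemma hasSum_exp_mul_poisson (r : ℝ≥0) (s : ℝ) :
    HasSum (fun n : ℕ => Real.exp (-r) * (r : ℝ) ^ n / n.factorial * Real.exp (s * n))
      (Real.exp (r * (Real.exp s - 1))) := by
  convert! (NormedSpace.expSeries_div_hasSum_exp ((r : ℝ) * Real.exp s)).mul_left
    (Real.exp (-r)) using 1
  · funext n
    rw [mul_pow, ← Real.exp_nat_mul, mul_comm s]
    ring
  · rw [← Real.exp_eq_exp_ℝ, ← Real.exp_add]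
    ring_nf

section Poisson

variable {Ω : Type*} [MeasurableSpace Ω] {P : Measure Ω} {N : Ω → ℝ} {a : ℝ≥0}

lemma integrable_exp_mul_of_map_eq_poisson (hN : Measurable N)
    (hlaw : P.map N = (poissonMeasure a).map (fun n : ℕ => (n : ℝ))) (s : ℝ) :
    Integrable (fun ω => Real.exp (s * N ω)) P := by
  have hm : Measurable fun x : ℝ => Real.exp (s * x) := by fun_prop
  have h : Integrable (fun x : ℝ => Real.exp (s * x)) (P.map N) := by
    rw [hlaw, integrable_map_measure hm.aestronglyMeasurable .of_discrete,
      integrable_poissonMeasure_iff]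
    simpa using (hasSum_exp_mul_poisson a s).summable
  exact h.comp_measurable hN

lemma mgf_of_map_eq_poisson (hN : Measurable N)
    (hlaw : P.map N = (poissonMeasure a).map (fun n : ℕ => (n : ℝ))) (s : ℝ) :
    mgf N P s = Real.exp (a * (Real.exp s - 1)) := by
  have hm : Measurable fun x : ℝ => Real.exp (s * x) := by fun_prop
  have h : mgf N P s = ∫ x, Real.exp (s * x) ∂(P.map N) := by
    rw [integral_map hN.aemeasurable hm.aestronglyMeasurable]; rfl
  rw [h, hlaw, integral_map .of_discrete hm.aestronglyMeasurable, integral_poissonMeasure]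
  simpa using (hasSum_exp_mul_poisson a s).tsum_eq

end Poisson

/-- Upper tail of a weighted sum of independent centred Poisson variables. The cumulant generating
function at `s` of a centred `Poisson(a)` variable of weight `c` is `a (e^{cs} - 1 - cs)`, which is
at most `a s ^ 2` if `|c s| ≤ 1`; the bound is the Chernoff bound at `s = x / (2 V)`. -/
lemma poisson_sum_upper_tail {Ω ι : Type*} [MeasurableSpace Ω] {P : Measure Ω}
    [IsProbabilityMeasure P] {N : ι → Ω → ℝ} {a : ι → ℝ≥0} (c : ι → ℝ) (A : Finset ι)
    (hN : ∀ u, Measurable (N u))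
    (hlaw : ∀ u, P.map (N u) = (poissonMeasure (a u)).map (fun n : ℕ => (n : ℝ)))
    (hind : iIndepFun N P) (hc : ∀ u, |c u| ≤ 1) {V x : ℝ} (hV : ∑ u ∈ A, (a u : ℝ) ≤ V)
    (hVpos : 0 < V) (hx : 0 ≤ x) (hxV : x ≤ 2 * V) :
    P.real {ω | x ≤ ∑ u ∈ A, c u * (N u ω - a u)} ≤ Real.exp (-(x ^ 2 / (4 * V))) := by
  set s : ℝ := x / (2 * V) with hs
  have hs0 : 0 ≤ s := by positivity
  have hs1 : s ≤ 1 := by rw [hs, div_le_one (by positivity)]; exact hxV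
  let X : ι → Ω → ℝ := fun u ω => c u * (N u ω - a u)
  have hXm : ∀ u, Measurable (X u) := fun u => ((hN u).sub_const _).const_mul _
  have hXind : iIndepFun X P :=
    hind.comp (fun u y => c u * (y - a u)) fun u => by fun_prop
  have hexp : ∀ u ω, Real.exp (s * X u ω)
      = Real.exp (-(s * c u * a u)) * Real.exp (s * c u * N u ω) := fun u ω => by
    rw [← Real.exp_add]; simp only [X]; ring_nf
  have hXint : ∀ u ∈ A, Integrable (fun ω => Real.exp (s * X u ω)) P := fun u _ => by
    simp_rw [hexp]
    exact (integrable_exp_mul_of_map_eq_poisson (hN u) (hlaw u) _).const_mul _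
  have hmgf : ∀ u, mgf (X u) P s ≤ Real.exp (a u * s ^ 2) := fun u => by
    have h1 : mgf (X u) P s = Real.exp (-(s * c u * a u)) * mgf (N u) P (s * c u) := by
      simp only [mgf, hexp, integral_const_mul]
    rw [h1, mgf_of_map_eq_poisson (hN u) (hlaw u), ← Real.exp_add, Real.exp_le_exp]
    have h3 : |s * c u| ≤ s := by
      rw [abs_mul, abs_of_nonneg hs0]
      exact mul_le_of_le_one_right hs0 (hc u)
    have h2 := (abs_le.1 (Real.abs_exp_sub_one_sub_id_le (h3.trans hs1))).2
    have h4 : (s * c u) ^ 2 ≤ s ^ 2 := sq_le_sq' (abs_le.1 h3).1 (abs_le.1 h3).2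
    calc _ = a u * (Real.exp (s * c u) - 1 - s * c u) := by ring
      _ ≤ a u * s ^ 2 := mul_le_mul_of_nonneg_left (h2.trans h4) (a u).2
  have hint : Integrable (fun ω => Real.exp (s * (∑ u ∈ A, X u) ω)) P :=
    hXind.integrable_exp_mul_sum hXm hXint
  have hch := measure_ge_le_exp_mul_mgf x hs0 hint
  have hset : {ω | x ≤ (∑ u ∈ A, X u) ω} = {ω | x ≤ ∑ u ∈ A, c u * (N u ω - a u)} := by
    ext ω; simp [X, Finset.sum_apply]
  rw [hset, hXind.mgf_sum hXm] at hch
  have hprod : ∏ u ∈ A, mgf (X u) P s ≤ Real.exp (V * s ^ 2) := by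
    refine (Finset.prod_le_prod (fun u _ => mgf_nonneg) fun u _ => hmgf u).trans ?_
    rw [← Real.exp_sum, Real.exp_le_exp, ← Finset.sum_mul]
    exact mul_le_mul_of_nonneg_right hV (sq_nonneg s)
  refine hch.trans ((mul_le_mul_of_nonneg_left hprod (Real.exp_pos _).le).trans (le_of_eq ?_))
  rw [← Real.exp_add, hs]
  congr 1
  field_simp
  ring

lemma poisson_sum_two_sided_tail {Ω ι : Type*} [MeasurableSpace Ω] {P : Measure Ω}
    [IsProbabilityMeasure P] {N : ι → Ω → ℝ} {a : ι → ℝ≥0} (c : ι → ℝ) (A : Finset ι)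
    (hN : ∀ u, Measurable (N u))
    (hlaw : ∀ u, P.map (N u) = (poissonMeasure (a u)).map (fun n : ℕ => (n : ℝ)))
    (hind : iIndepFun N P) (hc : ∀ u, |c u| ≤ 1) {V x : ℝ} (hV : ∑ u ∈ A, (a u : ℝ) ≤ V)
    (hVpos : 0 < V) (hx : 0 ≤ x) (hxV : x ≤ 2 * V) :
    P.real {ω | x ≤ |∑ u ∈ A, c u * (N u ω - a u)|} ≤ 2 * Real.exp (-(x ^ 2 / (4 * V))) := by
  have h1 := poisson_sum_upper_tail c A hN hlaw hind hc hV hVpos hx hxV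
  have h2 := poisson_sum_upper_tail (fun u => -c u) A hN hlaw hind (fun u => by simpa using hc u)
    hV hVpos hx hxV
  have hsub : {ω | x ≤ |∑ u ∈ A, c u * (N u ω - a u)|} ⊆
      {ω | x ≤ ∑ u ∈ A, c u * (N u ω - a u)} ∪ {ω | x ≤ ∑ u ∈ A, -c u * (N u ω - a u)} := by
    intro ω hω
    simpa [le_abs, Finset.sum_neg_distrib] using hω
  calc _ ≤ _ := measureReal_mono hsub
    _ ≤ _ := measureReal_union_le _ _
    _ ≤ _ := by linarith

/-- Concentration of the mean of the differences `N t - N (φ t)` over a set `M` of disjoint pairs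
`(t, φ t)` of independent Poisson variables with means at most `C`. -/
lemma poisson_pair_mean_tail {Ω ι : Type*} [DecidableEq ι] [MeasurableSpace Ω] {P : Measure Ω}
    [IsProbabilityMeasure P] {N : ι → Ω → ℝ} {a : ι → ℝ≥0} {M : Finset ι} {φ : ι → ι}
    (hN : ∀ u, Measurable (N u))
    (hlaw : ∀ u, P.map (N u) = (poissonMeasure (a u)).map (fun n : ℕ => (n : ℝ)))
    (hind : iIndepFun N P) (hinj : Set.InjOn φ M) (hdisj : ∀ t ∈ M, φ t ∉ M)
    {C ε : ℝ} (haC : ∀ u, (a u : ℝ) ≤ C) (hC : 0 < C) (hM : 0 < M.card)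
    (hε : 0 ≤ ε) (hεC : ε ≤ 4 * C) :
    P.real {ω | ε ≤ |(1 / (M.card : ℝ)) * ∑ t ∈ M, (N t ω - N (φ t) ω)
        - (1 / (M.card : ℝ)) * ∑ t ∈ M, ((a t : ℝ) - a (φ t))|}
      ≤ 2 * Real.exp (-((M.card : ℝ) * ε ^ 2 / (8 * C))) := by
  have hn : (0 : ℝ) < M.card := by exact_mod_cast hM
  have hd : Disjoint M (M.image φ) := by
    rw [Finset.disjoint_left]
    intro u hu hu'
    obtain ⟨t, ht, rfl⟩ := Finset.mem_image.1 hu'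
    exact hdisj t ht hu
  let c : ι → ℝ := fun u => if u ∈ M then 1 else -1
  have hc : ∀ u, |c u| ≤ 1 := fun u => by by_cases h : u ∈ M <;> simp [c, h]
  have hsum : ∀ f : ι → ℝ, ∑ u ∈ M ∪ M.image φ, c u * f u = ∑ t ∈ M, (f t - f (φ t)) := by
    intro f
    rw [Finset.sum_union hd, Finset.sum_image hinj, Finset.sum_sub_distrib, sub_eq_add_neg,
      ← Finset.sum_neg_distrib]
    congr 1
    · exact Finset.sum_congr rfl fun t ht => by simp [c, ht]
    · exact Finset.sum_congr rfl fun t ht => by simp [c, hdisj t ht]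
  have hV : ∑ u ∈ M ∪ M.image φ, (a u : ℝ) ≤ 2 * M.card * C := by
    calc _ ≤ ((M ∪ M.image φ).card : ℝ) * C := by
          rw [← nsmul_eq_mul]; exact Finset.sum_le_card_nsmul _ _ _ fun u _ => haC u
      _ = _ := by
          rw [Finset.card_union_of_disjoint hd, Finset.card_image_of_injOn hinj]
          push_cast; ring
  have key := poisson_sum_two_sided_tail c (M ∪ M.image φ) hN hlaw hind hc hV
    (by positivity) (x := M.card * ε) (by positivity) (by nlinarith)
  have hset : {ω | ε ≤ |(1 / (M.card : ℝ)) * ∑ t ∈ M, (N t ω - N (φ t) ω)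
        - (1 / (M.card : ℝ)) * ∑ t ∈ M, ((a t : ℝ) - a (φ t))|}
      = {ω | M.card * ε ≤ |∑ u ∈ M ∪ M.image φ, c u * (N u ω - a u)|} := by
    ext ω
    have e : (1 / (M.card : ℝ)) * ∑ t ∈ M, (N t ω - N (φ t) ω)
        - (1 / (M.card : ℝ)) * ∑ t ∈ M, ((a t : ℝ) - a (φ t))
        = (∑ u ∈ M ∪ M.image φ, c u * (N u ω - a u)) / M.card := by
      rw [hsum fun u => N u ω - a u]
      simp only [Finset.sum_sub_distrib]
      ring
    rw [Set.mem_ofPred_eq, Set.mem_ofPred_eq, e, abs_div, abs_of_pos hn, le_div_iff₀ hn, mul_comm]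
  rw [hset]
  refine key.trans (le_of_eq ?_)
  congr 2
  field_simp
  ring

/-! ### Combinatorics of the matching -/

lemma matchLoop_spec {T : ℕ} {W : Fin T → Finset ℕ} {h : ℕ} {ts : List (Fin T)}
    {L M : Finset (Fin T)} {φ : Fin T → Fin T} (hml : MatchLoop W h ts L M φ) :
    (∀ t ∈ M, t ∈ ts ∧ φ t ∈ L ∧ Matches h (W t) (W (φ t))) ∧ Set.InjOn φ M := by
  induction hml with
  | done => simp
  | @found t ts L M φ ht hmatch _ ih =>
    obtain ⟨ih1, ih2⟩ := ih
    have hne : ∀ s ∈ M, φ s ≠ φ t := fun s hs => (Finset.mem_erase.1 (ih1 s hs).2.1).1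
    refine ⟨fun s hs => ?_, ?_⟩
    · rcases Finset.mem_insert.1 hs with rfl | hs
      · exact ⟨List.mem_cons_self, ht, hmatch⟩
      · exact ⟨List.mem_cons_of_mem _ (ih1 s hs).1, Finset.mem_of_mem_erase (ih1 s hs).2.1,
          (ih1 s hs).2.2⟩
    · rw [Finset.coe_insert]
      intro s hs s' hs' heq
      rcases hs with rfl | hs <;> rcases hs' with rfl | hs'
      · rfl
      · exact absurd heq.symm (hne s' hs')
      · exact absurd heq (hne s hs)
      · exact ih2 hs hs' heq
  | pass _ _ ih =>
    exact ⟨fun s hs => ⟨List.mem_cons_of_mem _ (ih.1 s hs).1, (ih.1 s hs).2⟩, ih.2⟩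

lemma IsMatching.spec {T : ℕ} {W : Fin T → Finset ℕ} {h : ℕ} {M : Finset (Fin T)}
    {φ : Fin T → Fin T} (hM : IsMatching W h M φ) :
    (∀ t ∈ M, h ∈ W t ∧ Matches h (W t) (W (φ t))) ∧ Set.InjOn φ M := by
  obtain ⟨ts, -, hts, hml⟩ := hM
  obtain ⟨h1, h2⟩ := matchLoop_spec hml
  exact ⟨fun t ht => ⟨(hts t).1 (h1 t ht).1, (h1 t ht).2.2⟩, h2⟩

lemma lastWin_lt (W : Finset ℕ) {w : ℕ} (hw : 1 ≤ w) : lastWin W w < w :=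
  (Finset.sup_lt_iff (show ⊥ < w from hw)).2 fun _ hb => (Finset.mem_filter.1 hb).2

lemma gap_mem_Icc (W : Finset ℕ) {w : ℕ} (hw : 1 ≤ w) : gap W w ∈ Finset.Icc 1 w := by
  have := lastWin_lt W hw
  rw [Finset.mem_Icc, gap]
  omega

lemma gap_congr {W V : Finset ℕ} {h : ℕ} (hWV : W.filter (· < h) = V.filter (· < h)) {w : ℕ}
    (hw : w < h) : gap W w = gap V w := by
  have : W.filter (· < w) = V.filter (· < w) := by
    ext x
    have := congrArg (x ∈ ·) hWV
    simp only [Finset.mem_filter, eq_iff_iff] at this ⊢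
    constructor
    · rintro ⟨h1, h2⟩; exact ⟨(this.1 ⟨h1, h2.trans hw⟩).1, h2⟩
    · rintro ⟨h1, h2⟩; exact ⟨(this.2 ⟨h1, h2.trans hw⟩).1, h2⟩
  simp only [gap, lastWin, this]

/-! ### Intensities of matched episodes -/

lemma incrRate_of_le (θ : IBParams) {h ℓ : ℕ} {τ : ℝ} (hτ : (h : ℝ) ≤ τ) :
    incrRate θ h ℓ τ = θ.beta h ℓ * θ.lam h * Real.exp (-((τ - h) * θ.lam h)) := if_pos hτ

lemma incrRate_eq_zero (θ : IBParams) {h ℓ w : ℕ} {τ : ℝ} (hτ : τ < (h : ℝ) + 1) (hw : h < w) :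
    incrRate θ w ℓ τ = 0 := by
  have : (h : ℝ) + 1 ≤ w := by exact_mod_cast hw
  exact if_neg (by linarith)

/-- During round `h` only the ads shown up to round `h` are effective. -/
lemma convRate_of_lt (θ : IBParams) (W : Finset ℕ) {h : ℕ} {τ : ℝ} (hτ : τ < (h : ℝ) + 1) :
    convRate θ W τ = (if h ∈ W then incrRate θ h (gap W h) τ else 0)
      + ∑ w ∈ W.filter (· < h), incrRate θ w (gap W w) τ := by
  have h1 : convRate θ W τ = ∑ w ∈ W.filter (· ≤ h), incrRate θ w (gap W w) τ := by
    rw [convRate, Finset.sum_filter]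
    refine Finset.sum_congr rfl fun w _ => ?_
    split_ifs with hw
    · rfl
    · exact incrRate_eq_zero θ hτ (not_le.1 hw)
  rw [h1]
  split_ifs with hh
  · rw [← Finset.sum_insert (s := W.filter (· < h)) (a := h)
      (f := fun w => incrRate θ w (gap W w) τ) (by simp)]
    refine Finset.sum_congr ?_ fun _ _ => rfl
    ext x
    simp only [Finset.mem_filter, Finset.mem_insert]
    constructor
    · rintro ⟨hx, hxh⟩
      rcases hxh.eq_or_lt with rfl | hlt
      · exact Or.inl rfl
      · exact Or.inr ⟨hx, hlt⟩
    · rintro (rfl | ⟨hx, hlt⟩)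
      · exact ⟨hh, le_rfl⟩
      · exact ⟨hx, hlt.le⟩
  · rw [zero_add]
    refine Finset.sum_congr ?_ fun _ _ => rfl
    ext x
    simp only [Finset.mem_filter]
    refine and_congr_right fun hx => ⟨fun hxh => hxh.lt_of_ne ?_, le_of_lt⟩
    rintro rfl
    exact hh hx

/-- During round `h` the rates of matched episodes differ by the effect of the ad of round `h`. -/
lemma Matches.convRate_eq (θ : IBParams) {W V : Finset ℕ} {h : ℕ} (hWV : Matches h W V)
    (hh : h ∈ W) {τ : ℝ} (hτ : τ < (h : ℝ) + 1) :
    convRate θ W τ = incrRate θ h (gap W h) τ + convRate θ V τ := by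
  rw [convRate_of_lt θ W hτ, convRate_of_lt θ V hτ, if_pos hh, if_neg hWV.2, zero_add, hWV.1]
  congr 1
  refine Finset.sum_congr rfl fun w hw => ?_
  rw [gap_congr hWV.1 (Finset.mem_filter.1 hw).2]

lemma measurable_incrRate (θ : IBParams) (h ℓ : ℕ) : Measurable (incrRate θ h ℓ) :=
  Measurable.ite measurableSet_Ici (by fun_prop) measurable_const

lemma measurable_convRate (θ : IBParams) (W : Finset ℕ) : Measurable (convRate θ W) :=
  Finset.measurable_fun_sum _ fun _ _ => measurable_incrRate θ _ _

lemma incrRate_nonneg {θ : IBParams} {h ℓ : ℕ} (hl : 0 ≤ θ.lam h) (hb : 0 ≤ θ.beta h ℓ) (τ : ℝ) :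
    0 ≤ incrRate θ h ℓ τ := by
  unfold incrRate
  split_ifs <;> positivity

lemma lintegral_incrRate {θ : IBParams} {h ℓ : ℕ} (hl : 0 ≤ θ.lam h) (hb : 0 ≤ θ.beta h ℓ)
    {u v : ℝ} (hu : 0 ≤ u) (huv : u ≤ v) :
    ∫⁻ τ in Set.Ico ((h : ℝ) + u) (h + v), ENNReal.ofReal (incrRate θ h ℓ τ)
      = ENNReal.ofReal (θ.beta h ℓ *
          (Real.exp (-(u * θ.lam h)) - Real.exp (-(v * θ.lam h)))) := by
  have huv' : (h : ℝ) + u ≤ h + v := by linarith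
  set g : ℝ → ℝ := fun τ => θ.beta h ℓ * θ.lam h * Real.exp (-((τ - h) * θ.lam h)) with hg
  have hgc : Continuous g := by fun_prop
  have h1 : ∫⁻ τ in Set.Ico ((h : ℝ) + u) (h + v), ENNReal.ofReal (incrRate θ h ℓ τ)
      = ∫⁻ τ in Set.Ico ((h : ℝ) + u) (h + v), ENNReal.ofReal (g τ) :=
    setLIntegral_congr_fun measurableSet_Ico fun τ hτ => by
      simp only [hg]
      rw [incrRate_of_le θ (by linarith [hτ.1])]
  have hint : IntegrableOn g (Set.Ico ((h : ℝ) + u) (h + v)) :=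
    (hgc.integrableOn_Icc).mono_set Set.Ico_subset_Icc_self
  rw [h1, ← ofReal_integral_eq_lintegral_ofReal hint
    (Filter.Eventually.of_forall fun τ => by simp only [hg, Pi.zero_apply]; positivity)]
  congr 1
  rw [integral_Ico_eq_integral_Ioc, ← intervalIntegral.integral_of_le huv']
  have hder : ∀ τ ∈ Set.uIcc ((h : ℝ) + u) (h + v),
      HasDerivAt (fun τ => -(θ.beta h ℓ * Real.exp (-((τ - h) * θ.lam h)))) (g τ) τ := by
    intro τ _
    have h2 : HasDerivAt (fun τ : ℝ => -((τ - h) * θ.lam h)) (-(1 * θ.lam h)) τ :=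
      (((hasDerivAt_id τ).sub_const _).mul_const _).neg
    convert! (h2.exp.const_mul (θ.beta h ℓ)).neg using 1
    simp only [hg]
    ring
  rw [intervalIntegral.integral_eq_sub_of_hasDerivAt hder (hgc.intervalIntegrable _ _)]
  ring_nf

/-- On a subinterval of round `h`, the expected number of conversions of an episode winning `h`
exceeds that of a match by the mass of the exponential density started at `h`. -/
lemma Matches.intensity_sub {θ : IBParams} {W V : Finset ℕ} {h : ℕ} (hWV : Matches h W V)
    (hh : h ∈ W) (hl : 0 ≤ θ.lam h) (hb : 0 ≤ θ.beta h (gap W h))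
    (hV : ∀ τ, 0 ≤ convRate θ V τ) {u v : ℝ} (hu : 0 ≤ u) (huv : u ≤ v) (hv : v ≤ 1)
    (hfin : intensity (convRate θ V) (Set.Ico ((h : ℝ) + u) (h + v)) ≠ ∞) :
    ((intensity (convRate θ W) (Set.Ico ((h : ℝ) + u) (h + v))).toNNReal : ℝ)
      - (intensity (convRate θ V) (Set.Ico ((h : ℝ) + u) (h + v))).toNNReal
      = θ.beta h (gap W h) * (Real.exp (-(u * θ.lam h)) - Real.exp (-(v * θ.lam h))) := by
  have hsplit : intensity (convRate θ W) (Set.Ico ((h : ℝ) + u) (h + v))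
      = ENNReal.ofReal (θ.beta h (gap W h) *
          (Real.exp (-(u * θ.lam h)) - Real.exp (-(v * θ.lam h))))
        + intensity (convRate θ V) (Set.Ico ((h : ℝ) + u) (h + v)) := by
    rw [intensity, withDensity_apply _ measurableSet_Ico, intensity,
      withDensity_apply _ measurableSet_Ico, ← lintegral_incrRate hl hb hu huv,
      ← lintegral_add_left (measurable_incrRate θ _ _).ennreal_ofReal]
    refine setLIntegral_congr_fun measurableSet_Ico fun τ hτ => ?_
    rw [hWV.convRate_eq θ hh (by linarith [hτ.2]),
      ENNReal.ofReal_add (incrRate_nonneg hl hb τ) (hV τ)]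
  have hnn : 0 ≤ θ.beta h (gap W h) *
      (Real.exp (-(u * θ.lam h)) - Real.exp (-(v * θ.lam h))) :=
    mul_nonneg hb (sub_nonneg.2 (Real.exp_le_exp.2 (by nlinarith)))
  rw [hsplit, ENNReal.coe_toNNReal_eq_toReal, ENNReal.coe_toNNReal_eq_toReal,
    ENNReal.toReal_add ENNReal.ofReal_ne_top hfin, ENNReal.toReal_ofReal hnn]
  ring

/-! ### Conversion counts as independent Poisson variables -/

section Counts

variable {Ω : Type*} [MeasurableSpace Ω] {P : Measure Ω}

lemma measurable_ncard_of_encard {S : Ω → Set ℝ} {A : Set ℝ}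
    (hS : Measurable fun ω => (S ω ∩ A).encard) :
    Measurable fun ω => ((S ω ∩ A).ncard : ℝ) :=
  (Measurable.of_discrete (f := fun x : ℕ∞ => (x.toNat : ℝ))).comp hS

/-- The convention `ncard = 0` for infinite sets is harmless here: by `law_count`, a set of finite
intensity contains almost surely finitely many points. -/
lemma IsPoissonProcess.map_ncard {r : ℝ → ℝ} {S : Ω → Set ℝ} (hS : IsPoissonProcess r S P)
    {A : Set ℝ} (hA : MeasurableSet A) (hfin : intensity r A ≠ ∞) :
    P.map (fun ω => ((S ω ∩ A).ncard : ℝ))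
      = (poissonMeasure (intensity r A).toNNReal).map (fun n : ℕ => (n : ℝ)) := by
  have h := congrArg (Measure.map fun x : ℕ∞ => (x.toNat : ℝ)) (hS.law_count A hA hfin)
  rw [Measure.map_map .of_discrete (hS.measurable_count A hA),
    Measure.map_map .of_discrete .of_discrete] at h
  exact h

lemma IsSample.iIndepFun_ncard {θ : IBParams} {H T : ℕ} {W : Fin T → Finset ℕ}
    {C : Fin T → Ω → Set ℝ} (hs : IsSample θ H T W C P) {A : Set ℝ} (hA : MeasurableSet A) :
    iIndepFun (fun t ω => ((C t ω ∩ A).ncard : ℝ)) P := by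
  have h : iIndepFun (fun t ω => (C t ω ∩ A).encard) P := by
    rw [iIndepFun_iff_iIndep]
    exact iIndep_of_iIndep_of_le hs.indep fun t =>
      le_iSup (fun B : {B : Set ℝ // MeasurableSet B} =>
        MeasurableSpace.comap (fun ω => (C t ω ∩ B.1).encard) inferInstance) ⟨A, hA⟩
  exact h.comp (fun _ x => (x.toNat : ℝ)) fun _ => .of_discrete

end Counts

/-! ### Concentration of the moment estimates -/

section Sample

variable {Ω : Type*} [MeasurableSpace Ω] {P : Measure Ω} {θ : IBParams} {H T : ℕ}
  {W : Fin T → Finset ℕ} {C : Fin T → Ω → Set ℝ} {c_lam c_beta C_T : ℝ}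

lemma IsBounded.convRate_nonneg (hb : IsBounded θ H T W c_lam c_beta C_T)
    (hs : ∀ t, W t ⊆ Finset.Icc 1 H) (hcl : 0 < c_lam) (hcb : 0 < c_beta) (t : Fin T) (τ : ℝ) :
    0 ≤ convRate θ (W t) τ :=
  Finset.sum_nonneg fun w hw =>
    incrRate_nonneg (hcl.le.trans (hb.lam_ge w (hs t hw)))
      (hcb.le.trans (hb.beta_ge w (hs t hw) _
        (gap_mem_Icc _ (Finset.mem_Icc.1 (hs t hw)).1))) τ

lemma IsBounded.intensity_le (hb : IsBounded θ H T W c_lam c_beta C_T) {h : ℕ}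
    (hh : h ∈ Finset.Icc 1 H) {u v : ℝ} (hu : 0 ≤ u) (hv : v ≤ 1) (t : Fin T) :
    intensity (convRate θ (W t)) (Set.Ico ((h : ℝ) + u) (h + v)) ≤ ENNReal.ofReal C_T :=
  (measure_mono (Set.Ico_subset_Ico (by linarith) (by linarith))).trans (hb.mean_le t h hh)

lemma IsBounded.toNNReal_intensity_le (hb : IsBounded θ H T W c_lam c_beta C_T) (hC : 0 < C_T)
    {h : ℕ} (hh : h ∈ Finset.Icc 1 H) {u v : ℝ} (hu : 0 ≤ u) (hv : v ≤ 1) (t : Fin T) :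
    ((intensity (convRate θ (W t)) (Set.Ico ((h : ℝ) + u) (h + v))).toNNReal : ℝ) ≤ C_T := by
  have := ENNReal.toReal_mono ENNReal.ofReal_ne_top (hb.intensity_le hh hu hv t)
  rwa [ENNReal.toReal_ofReal hC.le] at this

/-- Means over matched pairs of the differences of the conversion counts in a subinterval of round
`h` concentrate around the mass which the exponential density started at `h` has there. -/
lemma matched_mean_tail [IsProbabilityMeasure P] (hs : IsSample θ H T W C P)
    (hb : IsBounded θ H T W c_lam c_beta C_T) (hcl : 0 < c_lam) (hcb : 0 < c_beta) (hC : 0 < C_T)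
    {h : ℕ} {M : Finset (Fin T)} {φ : Fin T → Fin T}
    (hM : ∀ t ∈ M, h ∈ W t ∧ Matches h (W t) (W (φ t))) (hinj : Set.InjOn φ M) (hn : 0 < M.card)
    {u v : ℝ} (hu : 0 ≤ u) (huv : u ≤ v) (hv : v ≤ 1) {ε : ℝ} (hε : 0 ≤ ε) (hεC : ε ≤ 4 * C_T) :
    P.real {ω | ε ≤ |(1 / (M.card : ℝ)) * ∑ t ∈ M,
          (((C t ω ∩ Set.Ico ((h : ℝ) + u) (h + v)).ncard : ℝ)
            - ((C (φ t) ω ∩ Set.Ico ((h : ℝ) + u) (h + v)).ncard : ℝ))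
        - (1 / (M.card : ℝ)) * (∑ t ∈ M, θ.beta h (gap (W t) h)) *
          (Real.exp (-(u * θ.lam h)) - Real.exp (-(v * θ.lam h)))|}
      ≤ 2 * Real.exp (-((M.card : ℝ) * ε ^ 2 / (8 * C_T))) := by
  obtain ⟨t₀, ht₀⟩ := Finset.card_pos.1 hn
  have hh : h ∈ Finset.Icc 1 H := hs.wins_subset t₀ (hM t₀ ht₀).1
  have hA : MeasurableSet (Set.Ico ((h : ℝ) + u) (h + v)) := measurableSet_Ico
  have hfin : ∀ t, intensity (convRate θ (W t)) (Set.Ico ((h : ℝ) + u) (h + v)) ≠ ∞ := fun t =>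
    ne_top_of_le_ne_top ENNReal.ofReal_ne_top (hb.intensity_le hh hu hv t)
  have key := poisson_pair_mean_tail
    (fun t => measurable_ncard_of_encard ((hs.poisson t).measurable_count _ hA))
    (fun t => (hs.poisson t).map_ncard hA (hfin t)) (hs.iIndepFun_ncard hA) hinj
    (fun t ht hφ => (hM t ht).2.2 (hM _ hφ).1)
    (fun t => hb.toNNReal_intensity_le hC hh hu hv t) hC hn hε hεC
  have hmean : ∑ t ∈ M,
      (((intensity (convRate θ (W t)) (Set.Ico ((h : ℝ) + u) (h + v))).toNNReal : ℝ)
        - (intensity (convRate θ (W (φ t))) (Set.Ico ((h : ℝ) + u) (h + v))).toNNReal)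
      = (∑ t ∈ M, θ.beta h (gap (W t) h)) *
          (Real.exp (-(u * θ.lam h)) - Real.exp (-(v * θ.lam h))) := by
    rw [Finset.sum_mul]
    exact Finset.sum_congr rfl fun t ht =>
      (hM t ht).2.intensity_sub (hM t ht).1 (hcl.le.trans (hb.lam_ge h hh))
        (hcb.le.trans (hb.beta_ge h hh _ (gap_mem_Icc _ (Finset.mem_Icc.1 hh).1)))
        (hb.convRate_nonneg hs.wins_subset hcl hcb _) hu huv hv (hfin _)
  rw [hmean, ← mul_assoc] at key
  exact key

/-- With probability at least `1 - δ` both moment estimates are `ε`-close to their means, for an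
`ε` below a prescribed accuracy `ε₀` and of order `√(log (1 / δ) / n)`. -/
lemma moments_close [IsProbabilityMeasure P] (hs : IsSample θ H T W C P)
    (hb : IsBounded θ H T W c_lam c_beta C_T) (hcl : 0 < c_lam) (hcb : 0 < c_beta) (hC : 0 < C_T)
    {h : ℕ} {M : Finset (Fin T)} {φ : Fin T → Fin T}
    (hM : ∀ t ∈ M, h ∈ W t ∧ Matches h (W t) (W (φ t))) (hinj : Set.InjOn φ M) (hn : 0 < M.card)
    {ε₀ δ : ℝ} (hε₀ : 0 < ε₀) (hε₀C : ε₀ ≤ 4 * C_T)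
    (hδ : 4 * Real.exp (-(ε₀ ^ 2 / (8 * C_T) * (M.card : ℝ))) < δ) (hδ2 : δ < 1 / 2) :
    ∃ ε : ℝ, ε ≤ ε₀ ∧
      ε ≤ Real.sqrt (24 * C_T) * Real.sqrt (Real.log (1 / δ) / (M.card : ℝ)) ∧
      1 - δ ≤ P.real {ω |
        |muHat h M φ (fun t => C t ω) - (1 / (M.card : ℝ)) * (∑ t ∈ M, θ.beta h (gap (W t) h)) *
          (1 - Real.exp (-(θ.lam h / 2)))| < ε ∧
        |etaHat h M φ (fun t => C t ω) - (1 / (M.card : ℝ)) * (∑ t ∈ M, θ.beta h (gap (W t) h)) *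
          (Real.exp (-(θ.lam h / 2)) - Real.exp (-θ.lam h))| < ε} := by
  have hn' : (0 : ℝ) < M.card := by exact_mod_cast hn
  have hδ0 : 0 < δ := lt_trans (by positivity) hδ
  have hlog0 : 0 < Real.log (4 / δ) := Real.log_pos (by rw [lt_div_iff₀ hδ0]; linarith)
  -- The accuracy at which the tail bounds of the two estimates add up to `δ`.
  set ε := Real.sqrt (8 * C_T * Real.log (4 / δ) / M.card) with hεdef
  have hε2 : ε ^ 2 = 8 * C_T * Real.log (4 / δ) / M.card := Real.sq_sqrt (by positivity)
  have hε : 0 ≤ ε := Real.sqrt_nonneg _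
  have hεε₀ : ε ≤ ε₀ := by
    refine Real.sqrt_le_iff.2 ⟨hε₀.le, ?_⟩
    have h1 : Real.log (4 / δ) < ε₀ ^ 2 / (8 * C_T) * M.card := by
      rw [Real.log_lt_iff_lt_exp (by positivity), div_lt_iff₀ hδ0]
      rw [Real.exp_neg] at hδ
      have := Real.exp_pos (ε₀ ^ 2 / (8 * C_T) * M.card)
      rwa [← div_eq_mul_inv, div_lt_iff₀ this, mul_comm] at hδ
    rw [div_le_iff₀ hn']
    calc 8 * C_T * Real.log (4 / δ) ≤ 8 * C_T * (ε₀ ^ 2 / (8 * C_T) * M.card) :=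
          mul_le_mul_of_nonneg_left h1.le (by positivity)
      _ = ε₀ ^ 2 * M.card := by field_simp
  have hεbound : ε ≤ Real.sqrt (24 * C_T) * Real.sqrt (Real.log (1 / δ) / (M.card : ℝ)) := by
    rw [← Real.sqrt_mul (by positivity)]
    refine Real.sqrt_le_sqrt ?_
    -- `4 ≤ δ⁻²` because `δ < 1 / 2`.
    have h1 : Real.log (4 / δ) ≤ 3 * Real.log (1 / δ) := by
      have : (3 : ℝ) * Real.log (1 / δ) = Real.log ((1 / δ) ^ 3) := by
        rw [Real.log_pow]; norm_num
      rw [this]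
      refine Real.log_le_log (by positivity) ?_
      rw [div_pow, one_pow, div_le_div_iff₀ hδ0 (by positivity)]
      nlinarith [mul_pos hδ0 hδ0]
    rw [mul_div_assoc', div_le_div_iff_of_pos_right hn']
    nlinarith
  refine ⟨ε, hεε₀, hεbound, ?_⟩
  have hexp : 2 * Real.exp (-((M.card : ℝ) * ε ^ 2 / (8 * C_T))) = δ / 2 := by
    have : (M.card : ℝ) * ε ^ 2 / (8 * C_T) = Real.log (4 / δ) := by rw [hε2]; field_simp
    rw [this, Real.exp_neg, Real.exp_log (by positivity)]
    field_simp
    norm_num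
  have t1 := matched_mean_tail hs hb hcl hcb hC hM hinj hn le_rfl
    (by norm_num : (0 : ℝ) ≤ 1 / 2) (by norm_num) hε (hεε₀.trans hε₀C)
  have t2 := matched_mean_tail hs hb hcl hcb hC hM hinj hn (by norm_num : (0 : ℝ) ≤ 1 / 2)
    (by norm_num) le_rfl hε (hεε₀.trans hε₀C)
  rw [hexp] at t1 t2
  have e1 : -(1 / 2 * θ.lam h) = -(θ.lam h / 2) := by ring
  simp only [add_zero, zero_mul, neg_zero, Real.exp_zero, e1, one_mul] at t1 t2
  set G := {ω |
        |muHat h M φ (fun t => C t ω) - (1 / (M.card : ℝ)) * (∑ t ∈ M, θ.beta h (gap (W t) h)) *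
          (1 - Real.exp (-(θ.lam h / 2)))| < ε ∧
        |etaHat h M φ (fun t => C t ω) - (1 / (M.card : ℝ)) * (∑ t ∈ M, θ.beta h (gap (W t) h)) *
          (Real.exp (-(θ.lam h / 2)) - Real.exp (-θ.lam h))| < ε} with hG
  have hGc : P.real Gᶜ ≤ δ := by
    refine (measureReal_mono (fun ω hω => ?_)).trans
      ((measureReal_union_le _ _).trans ((add_le_add t1 t2).trans (by linarith)))
    rw [hG, Set.mem_compl_iff, Set.mem_ofPred_eq, not_and_or, not_lt, not_lt] at hω
    exact hω
  have h1 : (1 : ℝ) ≤ P.real G + P.real Gᶜ := by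
    have := measureReal_union_le (μ := P) G Gᶜ
    rwa [Set.union_compl_self, probReal_univ] at this
  linarith

end Sample

/-! ### Stability of the estimators -/

lemma abs_log_sub_log_le {x y m : ℝ} (hm : 0 < m) (hx : m ≤ x) (hy : m ≤ y) :
    |Real.log x - Real.log y| ≤ |x - y| / m := by
  have key : ∀ {x y : ℝ}, m ≤ x → m ≤ y → Real.log x - Real.log y ≤ |x - y| / m := by
    intro x y hx hy
    have hx0 := hm.trans_le hx
    have hy0 := hm.trans_le hy
    rw [← Real.log_div hx0.ne' hy0.ne']
    calc Real.log (x / y) ≤ x / y - 1 := Real.log_le_sub_one_of_pos (by positivity)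
      _ = (x - y) / y := by field_simp
      _ ≤ |x - y| / y := by gcongr; exact le_abs_self _
      _ ≤ |x - y| / m := by gcongr
  rw [abs_le]
  refine ⟨?_, key hx hy⟩
  have := key hy hx
  rw [abs_sub_comm] at this
  linarith

lemma lamHat_stable {μ η μ' η' m ε : ℝ} (hm : 0 < m) (hμ : m ≤ μ) (hη : m ≤ η)
    (hε : ε ≤ m / 2) (h1 : |μ' - μ| < ε) (h2 : |η' - η| < ε) :
    0 < μ' ∧ 0 < η' ∧ |lamHat μ' η' - lamHat μ η| ≤ 8 / m * ε := by
  have hμ' : m / 2 ≤ μ' := by linarith [(abs_lt.1 h1).1]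
  have hη' : m / 2 ≤ η' := by linarith [(abs_lt.1 h2).1]
  refine ⟨by linarith, by linarith, ?_⟩
  have l1 := (abs_log_sub_log_le (half_pos hm) hμ' (by linarith : m / 2 ≤ μ)).trans
    (div_le_div_of_nonneg_right h1.le (half_pos hm).le)
  have l2 := (abs_log_sub_log_le (half_pos hm) hη' (by linarith : m / 2 ≤ η)).trans
    (div_le_div_of_nonneg_right h2.le (half_pos hm).le)
  have e : ε / (m / 2) = 2 / m * ε := by field_simp
  rw [e] at l1 l2
  have e' : 8 / m * ε = 4 * (2 / m * ε) := by ring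
  rw [e', lamHat, lamHat, abs_le]
  rw [abs_le] at l1 l2
  constructor <;> linarith [l1.1, l1.2, l2.1, l2.2]

lemma betaHat_stable {μ η μ' η' b B K D ε : ℝ} (hD : 0 < D) (hD' : D ≤ μ - η)
    (hb : b * (μ - η) = μ ^ 2) (hb0 : 0 ≤ b) (hbB : b ≤ B) (hμ0 : 0 ≤ μ) (hμK : μ ≤ K)
    (hε : ε ≤ D / 4) (hεK : ε ≤ K) (h1 : |μ' - μ| < ε) (h2 : |η' - η| < ε) :
    μ' ≠ η' ∧ |betaHat μ' η' - b| ≤ (2 * (3 * K + 2 * B) / D) * ε := by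
  have hε0 : 0 < ε := (abs_nonneg _).trans_lt h1
  have h1' := abs_lt.1 h1
  have h2' := abs_lt.1 h2
  have hden : D / 2 ≤ μ' - η' := by linarith
  have hden0 : 0 < μ' - η' := by linarith
  refine ⟨fun h => by simp [h] at hden0, ?_⟩
  have e : betaHat μ' η' - b
      = ((μ' - μ) * (μ' + μ) - b * ((μ' - μ) - (η' - η))) / (μ' - η') := by
    rw [betaHat, div_sub' hden0.ne']
    congr 1
    linear_combination -hb
  have hnum : |(μ' - μ) * (μ' + μ) - b * ((μ' - μ) - (η' - η))| ≤ (3 * K + 2 * B) * ε := by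
    have a1 : |(μ' - μ) * (μ' + μ)| ≤ ε * (3 * K) := by
      rw [abs_mul]
      refine mul_le_mul h1.le ?_ (abs_nonneg _) hε0.le
      rw [abs_le]; constructor <;> linarith
    have a2 : |b * ((μ' - μ) - (η' - η))| ≤ B * (2 * ε) := by
      rw [abs_mul, abs_of_nonneg hb0]
      refine mul_le_mul hbB ?_ (abs_nonneg _) (hb0.trans hbB)
      rw [abs_le]; constructor <;> linarith
    calc _ ≤ _ := abs_sub _ _
      _ ≤ _ := add_le_add a1 a2
      _ = _ := by ring
  rw [e, abs_div, abs_of_pos hden0]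
  calc _ ≤ (3 * K + 2 * B) * ε / (D / 2) :=
        div_le_div₀ ((abs_nonneg _).trans hnum) hnum (half_pos hD) hden
    _ = _ := by field_simp

/-! ### The confidence intervals -/

lemma exp_neg_eq_sq_exp_neg_half (x : ℝ) : Real.exp (-x) = Real.exp (-(x / 2)) ^ 2 := by
  rw [← Real.exp_nat_mul]
  congr 1
  push_cast
  ring

lemma lamHat_eq {b l : ℝ} (hb : 0 < b) (hl : 0 < l) :
    lamHat (b * (1 - Real.exp (-(l / 2)))) (b * (Real.exp (-(l / 2)) - Real.exp (-l))) = l := by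
  have hq : Real.exp (-(l / 2)) < 1 := Real.exp_lt_one_iff.2 (by linarith)
  have hμ : 0 < b * (1 - Real.exp (-(l / 2))) := mul_pos hb (by linarith)
  have e : b * (Real.exp (-(l / 2)) - Real.exp (-l))
      = b * (1 - Real.exp (-(l / 2))) * Real.exp (-(l / 2)) := by
    rw [exp_neg_eq_sq_exp_neg_half l]
    ring
  rw [lamHat, e, Real.log_mul hμ.ne' (Real.exp_pos _).ne', Real.log_exp]
  ring

/-- Without matched episodes the range of admissible `δ` is empty. -/
lemma card_pos_of_four_mul_exp_lt {α : Type*} {M : Finset α} {C₀ δ : ℝ}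
    (hδ : 4 * Real.exp (-(C₀ * (M.card : ℝ))) < δ) (hδ2 : δ < 1 / 2) : 0 < M.card := by
  rcases Nat.eq_zero_or_pos M.card with h | h
  · rw [h] at hδ
    norm_num at hδ
    linarith
  · exact h

theorem theorem1 (c_lam c_beta C_T : ℝ) (hc_lam : 0 < c_lam) (hc_beta : 0 < c_beta)
    (hC_T : 0 < C_T) :
    -- estimation of `λ_h`, for `λ_h ≤ C_lam`
    (∀ C_lam : ℝ, ∃ C₀ C₁ : ℝ, 0 < C₀ ∧ 0 < C₁ ∧
      ∀ (Ω : Type*) [MeasurableSpace Ω] (P : Measure Ω) [IsProbabilityMeasure P]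
        (θ : IBParams) (H T : ℕ) (W : Fin T → Finset ℕ) (C : Fin T → Ω → Set ℝ),
        IsSample θ H T W C P → IsBounded θ H T W c_lam c_beta C_T →
        ∀ h : ℕ, h ≤ H → θ.lam h ≤ C_lam →
        ∀ (M : Finset (Fin T)) (φ : Fin T → Fin T), IsMatching W h M φ →
        ∀ δ : ℝ, 4 * Real.exp (-(C₀ * (M.card : ℝ))) < δ → δ < 1 / 2 →
          1 - δ ≤ P.real {ω |
            0 < muHat h M φ (fun t => C t ω) ∧ 0 < etaHat h M φ (fun t => C t ω) ∧
            |lamHat (muHat h M φ fun t => C t ω) (etaHat h M φ fun t => C t ω) - θ.lam h|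
              ≤ C₁ * Real.sqrt (Real.log (1 / δ) / (M.card : ℝ))}) ∧
    -- estimation of `β_h(ℓ)`
    (∃ C₀ C₂ : ℝ, 0 < C₀ ∧ 0 < C₂ ∧
      ∀ (Ω : Type*) [MeasurableSpace Ω] (P : Measure Ω) [IsProbabilityMeasure P]
        (θ : IBParams) (H T : ℕ) (W : Fin T → Finset ℕ) (C : Fin T → Ω → Set ℝ),
        IsSample θ H T W C P → IsBounded θ H T W c_lam c_beta C_T →
        ∀ h ℓ : ℕ, h ≤ H → ℓ ≤ h →
        ∀ (M : Finset (Fin T)) (φ : Fin T → Fin T), IsMatching W h M φ →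
        ∀ δ : ℝ, 4 * Real.exp (-(C₀ * ((slice W h ℓ M).card : ℝ))) < δ → δ < 1 / 2 →
          1 - δ ≤ P.real {ω |
            muHat h (slice W h ℓ M) φ (fun t => C t ω)
              ≠ etaHat h (slice W h ℓ M) φ (fun t => C t ω) ∧
            |betaHat (muHat h (slice W h ℓ M) φ fun t => C t ω)
                (etaHat h (slice W h ℓ M) φ fun t => C t ω) - θ.beta h ℓ|
              ≤ C₂ * Real.sqrt (Real.log (1 / δ) / ((slice W h ℓ M).card : ℝ))}) := by
  have hq0 : Real.exp (-(c_lam / 2)) < 1 := Real.exp_lt_one_iff.2 (by linarith)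
  have hq0' : 0 < 1 - Real.exp (-(c_lam / 2)) := by linarith
  refine ⟨fun C_lam => ?_, ?_⟩
  · -- A lower bound for the means of both moment estimates.
    set m := c_beta * (1 - Real.exp (-(c_lam / 2))) * Real.exp (-(C_lam / 2)) with hm
    have hm0 : 0 < m := by positivity
    set ε₀ := min (m / 2) (4 * C_T) with hε₀
    have hε₀0 : 0 < ε₀ := lt_min (by positivity) (by positivity)
    refine ⟨ε₀ ^ 2 / (8 * C_T), 8 / m * Real.sqrt (24 * C_T), by positivity, by positivity, ?_⟩
    intro Ω _ P _ θ H T W C hs hb h _ hlC M φ hM δ hδ hδ2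
    have hn := card_pos_of_four_mul_exp_lt hδ hδ2
    have hn' : (0 : ℝ) < M.card := by exact_mod_cast hn
    obtain ⟨hM1, hinj⟩ := hM.spec
    obtain ⟨t₀, ht₀⟩ := Finset.card_pos.1 hn
    have hh : h ∈ Finset.Icc 1 H := hs.wins_subset t₀ (hM1 t₀ ht₀).1
    have hl := hb.lam_ge h hh
    obtain ⟨ε, hε1, hε2, hP⟩ := moments_close hs hb hc_lam hc_beta hC_T hM1 hinj hn hε₀0
      (min_le_right _ _) hδ hδ2
    refine hP.trans (measureReal_mono fun ω hω => ?_)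
    set b := (1 / (M.card : ℝ)) * (∑ t ∈ M, θ.beta h (gap (W t) h)) with hbdef
    have hbge : c_beta ≤ b := by
      have : (M.card : ℝ) * c_beta ≤ ∑ t ∈ M, θ.beta h (gap (W t) h) := by
        rw [← nsmul_eq_mul]
        exact Finset.card_nsmul_le_sum _ _ _ fun t _ =>
          hb.beta_ge h hh _ (gap_mem_Icc _ (Finset.mem_Icc.1 hh).1)
      rw [hbdef, one_div_mul_eq_div, le_div_iff₀ hn']
      linarith
    have hb0 : 0 < b := hc_beta.trans_le hbge
    have hq : Real.exp (-(θ.lam h / 2)) ≤ Real.exp (-(c_lam / 2)) :=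
      Real.exp_le_exp.2 (by linarith)
    have hqC : Real.exp (-(C_lam / 2)) ≤ Real.exp (-(θ.lam h / 2)) :=
      Real.exp_le_exp.2 (by linarith)
    have hbase : c_beta * (1 - Real.exp (-(c_lam / 2))) ≤ b * (1 - Real.exp (-(θ.lam h / 2))) :=
      mul_le_mul hbge (by linarith) hq0'.le hb0.le
    have hμ : m ≤ b * (1 - Real.exp (-(θ.lam h / 2))) :=
      (mul_le_of_le_one_right (by positivity)
        (hqC.trans (hq.trans hq0.le))).trans hbase
    have hη : m ≤ b * (Real.exp (-(θ.lam h / 2)) - Real.exp (-θ.lam h)) := by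
      have e : b * (Real.exp (-(θ.lam h / 2)) - Real.exp (-θ.lam h))
          = b * (1 - Real.exp (-(θ.lam h / 2))) * Real.exp (-(θ.lam h / 2)) := by
        rw [exp_neg_eq_sq_exp_neg_half (θ.lam h)]
        ring
      rw [e]
      exact mul_le_mul hbase hqC (Real.exp_pos _).le (by linarith)
    obtain ⟨p1, p2, p3⟩ := lamHat_stable hm0 hμ hη (hε1.trans (min_le_left _ _)) hω.1 hω.2
    rw [lamHat_eq hb0 (hc_lam.trans_le hl)] at p3
    refine ⟨p1, p2, p3.trans ?_⟩
    rw [mul_assoc]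
    exact mul_le_mul_of_nonneg_left hε2 (by positivity)
  · -- A lower bound for `μ - η = β (1 - e^{-λ/2})²`, and an upper bound for `β`.
    set D := c_beta * (1 - Real.exp (-(c_lam / 2))) ^ 2 with hD
    have hD0 : 0 < D := by positivity
    set B := C_T / (1 - Real.exp (-(c_lam / 2))) with hB
    have hB0 : 0 < B := by positivity
    set ε₀ := min (D / 4) C_T with hε₀
    have hε₀0 : 0 < ε₀ := lt_min (by positivity) hC_T
    refine ⟨ε₀ ^ 2 / (8 * C_T), 2 * (3 * C_T + 2 * B) / D * Real.sqrt (24 * C_T), by positivity,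
      by positivity, ?_⟩
    intro Ω _ P _ θ H T W C hs hb h ℓ _ _ M φ hM δ hδ hδ2
    have hn := card_pos_of_four_mul_exp_lt hδ hδ2
    have hn' : (0 : ℝ) < (slice W h ℓ M).card := by exact_mod_cast hn
    obtain ⟨hM1, hinj⟩ := hM.spec
    have hsub : slice W h ℓ M ⊆ M := Finset.filter_subset _ _
    have hgap : ∀ t ∈ slice W h ℓ M, gap (W t) h = ℓ := fun t ht => (Finset.mem_filter.1 ht).2
    obtain ⟨t₀, ht₀⟩ := Finset.card_pos.1 hn
    have ht₀M := hM1 t₀ (hsub ht₀)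
    have hh : h ∈ Finset.Icc 1 H := hs.wins_subset t₀ ht₀M.1
    have hl := hb.lam_ge h hh
    obtain ⟨ε, hε1, hε2, hP⟩ := moments_close hs hb hc_lam hc_beta hC_T
      (fun t ht => hM1 t (hsub ht)) (hinj.mono (Finset.coe_subset.2 hsub)) hn hε₀0
      ((min_le_right _ _).trans (by linarith)) hδ hδ2
    refine hP.trans (measureReal_mono fun ω hω => ?_)
    have hmean : (1 / ((slice W h ℓ M).card : ℝ)) *
        (∑ t ∈ slice W h ℓ M, θ.beta h (gap (W t) h)) = θ.beta h ℓ := by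
      rw [Finset.sum_congr rfl fun t ht => by rw [hgap t ht], Finset.sum_const, nsmul_eq_mul]
      field_simp
    rw [hmean] at hω
    have hbge : c_beta ≤ θ.beta h ℓ :=
      hb.beta_ge h hh _ (hgap t₀ ht₀ ▸ gap_mem_Icc _ (Finset.mem_Icc.1 hh).1)
    have hb0 : 0 < θ.beta h ℓ := hc_beta.trans_le hbge
    have hq : Real.exp (-(θ.lam h / 2)) ≤ Real.exp (-(c_lam / 2)) :=
      Real.exp_le_exp.2 (by linarith)
    have hq1 : 0 < 1 - Real.exp (-(θ.lam h / 2)) := by linarith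
    have hdiff : θ.beta h ℓ * (1 - Real.exp (-(θ.lam h / 2)))
        - θ.beta h ℓ * (Real.exp (-(θ.lam h / 2)) - Real.exp (-θ.lam h))
        = θ.beta h ℓ * (1 - Real.exp (-(θ.lam h / 2))) ^ 2 := by
      rw [exp_neg_eq_sq_exp_neg_half (θ.lam h)]
      ring
    -- The mean `β (1 - e^{-λ/2})` is part of the expected number of conversions in round `h`.
    have hμC : θ.beta h ℓ * (1 - Real.exp (-(θ.lam h / 2))) ≤ C_T := by
      have e := ht₀M.2.intensity_sub ht₀M.1 (hc_lam.le.trans hl)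
        (by rw [hgap t₀ ht₀]; exact hb0.le)
        (hb.convRate_nonneg hs.wins_subset hc_lam hc_beta _) le_rfl
        (by norm_num : (0 : ℝ) ≤ 1 / 2) (by norm_num)
        (ne_top_of_le_ne_top ENNReal.ofReal_ne_top
          (hb.intensity_le hh le_rfl (by norm_num) _))
      have e1 : -(1 / 2 * θ.lam h) = -(θ.lam h / 2) := by ring
      rw [hgap t₀ ht₀, e1, zero_mul, neg_zero, Real.exp_zero] at e
      have h1 := hb.toNNReal_intensity_le hC_T hh le_rfl (by norm_num : (1 / 2 : ℝ) ≤ 1) t₀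
      have h2 := NNReal.coe_nonneg
        (intensity (convRate θ (W (φ t₀))) (Set.Ico ((h : ℝ) + 0) (h + 1 / 2))).toNNReal
      linarith
    have hβB : θ.beta h ℓ ≤ B := by
      rw [hB, le_div_iff₀ hq0']
      exact (mul_le_mul_of_nonneg_left (by linarith) hb0.le).trans hμC
    obtain ⟨p1, p2⟩ := betaHat_stable (b := θ.beta h ℓ) (B := B) (K := C_T) hD0
      (by rw [hdiff]
          exact mul_le_mul hbge (pow_le_pow_left₀ hq0'.le (by linarith) 2) (by positivity) hb0.le)
      (by rw [hdiff]; ring) hb0.le hβB (by positivity) hμC (hε1.trans (min_le_left _ _))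
      (hε1.trans (min_le_right _ _)) hω.1 hω.2
    refine ⟨p1, p2.trans ?_⟩
    rw [mul_assoc]
    exact mul_le_mul_of_nonneg_left hε2 (by positivity)
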